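/- Let $\mathsf A$ be an abelian category. For a class of objects $\mathsf X$ put $\mathsf X^\perp=\{M : \mathrm{Ext}^1(X,M)=0 \text{ for all } X\in\mathsf X\}$ and ${}^\perp\mathsf X=\{M : \mathrm{Ext}^1(M,X)=0 \text{ for all } X\in\mathsf X\}$. A pair $(\mathsf X,\mathsf Y)$ of full subcategories is a \emph{cotorsion pair} if $\mathsf X^\perp=\mathsf Y$ and ${}^\perp\mathsf Y=\mathsf X$; it is \emph{complete} if moreover every object $M$ admits an epimorphism $X\to M$ with $X\in\mathsf X$ and kernel in $\mathsf X^\perp$, and a monomorphism $M\to Y$ with $Y\in\mathsf Y$ and cokernel in ${}^\perp\mathsf Y$. Let $Q$ be a (small) quiver with vertex set $Q_0$. Define subsets $V_\alpha\subseteq Q_0$ by transfinite recursion: $V_0=\emptyset$; $V_{\alpha+1}$ is the set of vertices that are not the target of any arrow with source outside $\bigcup_{\beta\le\alpha}V_\beta$; and $V_\alpha=\bigcup_{\beta<\alpha}V_\beta$ for limit ordinals $\alpha$. The quiver $Q$ is \emph{left rooted} if $V_\lambda=Q_0$ for some ordinal $\lambda$, and \emph{right rooted} if the opposite quiver $Q^{\mathrm{op}}$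 is left rooted. Let $\mathrm{Rep}(Q,\mathsf A)$ be the abelian category of $\mathsf A$-valued representations of $Q$, and for a subcategory $\mathsf X$ of $\mathsf A$ let $\mathrm{Rep}(Q,\mathsf X)$ consist of the representations $F$ with $F(i)\in\mathsf X$ for all $i\in Q_0$. When $\mathsf A$ has small coproducts, let $\varphi_i^F:\bigoplus_{a:\,j\to i}F(j)\to F(i)$ be the morphism induced by the $F(a)$, over all arrows $a$ with target $i$, and let $\Phi(\mathsf X)$ consist of the representations $F$ such that, for every vertex $i$, $\varphi_i^F$ is a monomorphism with cokernel in $\mathsf X$. Dually, when $\mathsf A$ has small products, let $\psi_i^F:F(i)\to\prod_{a:\,i\to j}F(j)$ be the induced morphism, over all arrows $a$ with source $i$, and let $\Psi(\mathsf X)$ consist of the representations $F$ such that, for every vertex $i$, $\psi_i^F$ is an epimorphism with kernel in $\mathsf X$. Let $(\mathsf X,\mathsf Y)$ be a complete cotorsion pair in $\mathsf A$. (a) If $Q$ is left rooted and $\mathsf A$ satisfies AB4 (small coproducts exist and are exact), then $(\Phi(\mathsf X),\mathrm{Rep}(Q,\mathsf Y))$ is a complete cotorsion pair in $\mathrm{Rep}(Q,\mathsf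 A)$. (b) If $Q$ is right rooted and $\mathsf A$ satisfies AB4* (small products exist and are exact), then $(\mathrm{Rep}(Q,\mathsf X),\Psi(\mathsf Y))$ is a complete cotorsion pair in $\mathrm{Rep}(Q,\mathsf A)$. -/

import Mathlib

open CategoryTheory CategoryTheory.Limits

universe w v u

noncomputable section

namespace QuiverCotorsion

/-! ### Cotorsion pairs in an abelian category -/

section Cotorsion

variable {C : Type u} [Category.{v} C] [Abelian C]

/-- `Ext¹(M, N) = 0`. The `Ext`-groups are taken in a universe in which they always exist, so that
no smallness condition on `C` is needed. -/
def ExtOneVanishes (M N : C) : Prop :=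
  haveI : HasExt.{max u v} C := HasExt.standard C
  Subsingleton (Abelian.Ext.{max u v} M N 1)

/-- `X^⊥`: the objects `M` with `Ext¹(P, M) = 0` for all `P` in `X`. -/
def rightPerp (X : ObjectProperty C) : ObjectProperty C :=
  fun M => ∀ P : C, X P → ExtOneVanishes P M

/-- `^⊥X`: the objects `M` with `Ext¹(M, P) = 0` for all `P` in `X`. -/
def leftPerp (X : ObjectProperty C) : ObjectProperty C :=
  fun M => ∀ P : C, X P → ExtOneVanishes M P

/-- `(X, Y)` is a cotorsion pair: `X^⊥ = Y` and `^⊥Y = X`. These equalities force both classes to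
be closed under isomorphisms, to contain the zero objects and to be closed under finite direct
sums, i.e. to be full additive subcategories closed under isomorphisms. -/
structure IsCotorsionPair (X Y : ObjectProperty C) : Prop where
  rightPerp_eq : rightPerp X = Y
  leftPerp_eq : leftPerp Y = X

/-- `f : P ⟶ M` is a special `X`-precover of `M`. -/
structure IsSpecialPrecover (X : ObjectProperty C) {P M : C} (f : P ⟶ M) : Prop where
  epi : Epi f
  mem : X P
  kernel_mem : rightPerp X (kernel f)

/-- `g : M ⟶ P` is a special `X`-preenvelope of `M`. -/
structure IsSpecialPreenvelope (X : ObjectProperty C) {M P : C} (g : M ⟶ P) : Prop where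
  mono : Mono g
  mem : X P
  cokernel_mem : leftPerp X (cokernel g)

/-- Every object has a special `X`-precover. -/
def IsSpecialPrecovering (X : ObjectProperty C) : Prop :=
  ∀ M : C, ∃ (P : C) (f : P ⟶ M), IsSpecialPrecover X f

/-- Every object has a special `X`-preenvelope. -/
def IsSpecialPreenveloping (X : ObjectProperty C) : Prop :=
  ∀ M : C, ∃ (P : C) (g : M ⟶ P), IsSpecialPreenvelope X g

/-- A complete cotorsion pair: a cotorsion pair `(X, Y)` such that every object has a special
`X`-precover and a special `Y`-preenvelope. -/
structure IsCompleteCotorsionPair (X Y : ObjectProperty C) : Prop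
    extends IsCotorsionPair X Y where
  enough_projectives : IsSpecialPrecovering X
  enough_injectives : IsSpecialPreenveloping Y

end Cotorsion

/-! ### Rooted quivers -/

section Rooted

variable (Q : Type w) [Quiver.{w} Q]

/-- The transfinite sequence of sets of vertices `V_α`: `V_0 = ∅`; `V_{α+1}` consists of the
vertices `i` that are not the target of any arrow whose source lies outside `⋃_{β ≤ α} V_β`; and
`V_α = ⋃_{β < α} V_β` for a limit ordinal `α`. See `rootedSeq_zero`, `rootedSeq_succ` and
`rootedSeq_limit`. -/
def rootedSeq (α : Ordinal.{w}) : Set Q :=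
  {i | (Order.IsSuccLimit α ∧ ∃ β : Set.Iio α, i ∈ rootedSeq β.1) ∨
    (¬ Order.IsSuccLimit α ∧ α ≠ 0 ∧
      ∀ (j : Q) (_ : j ⟶ i), ∃ β : Set.Iio α, j ∈ rootedSeq β.1)}
termination_by α
decreasing_by all_goals exact β.2

theorem rootedSeq_zero : rootedSeq Q 0 = ∅ := by
  rw [rootedSeq]
  ext i
  simp

theorem rootedSeq_succ (α : Ordinal.{w}) :
    rootedSeq Q (Order.succ α) =
      {i | ¬ ∃ (j : Q) (_ : j ⟶ i), j ∉ ⋃ β ∈ Set.Iic α, rootedSeq Q β} := by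
  rw [rootedSeq]
  ext i
  simp

theorem rootedSeq_limit (α : Ordinal.{w}) (h : Order.IsSuccLimit α) :
    rootedSeq Q α = ⋃ β ∈ Set.Iio α, rootedSeq Q β := by
  rw [rootedSeq]
  ext i
  simp [h]

/-- `Q` is left rooted: some `V_λ` is the set of all vertices. -/
def IsLeftRooted : Prop :=
  ∃ l : Ordinal.{w}, rootedSeq Q l = Set.univ

/-- `Q` is right rooted: the opposite quiver is left rooted. -/
def IsRightRooted : Prop :=
  IsLeftRooted Qᵒᵖ

end Rooted

/-! ### Representations of quivers -/

section Representations

variable (Q : Type w) [Quiver.{w} Q] (A : Type u) [Category.{v} A]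

/-- The category of `A`-valued representations of `Q`: functors from the free category on `Q`
to `A`. -/
abbrev Rep := Paths Q ⥤ A

variable {Q A}

/-- The object `F(i)` of `A` at the vertex `i`. -/
abbrev Rep.at (F : Rep Q A) (i : Q) : A := F.obj ((Paths.of Q).obj i)

/-- The morphism `F(a) : F(i) ⟶ F(j)` given by an arrow `a : i ⟶ j`. -/
abbrev Rep.arrow (F : Rep Q A) {i j : Q} (a : i ⟶ j) : F.at i ⟶ F.at j :=
  F.map ((Paths.of Q).map a)

/-- `Rep(Q, X)`: the representations with all values in `X`. -/
def repIn (Q : Type w) [Quiver.{w} Q] (X : ObjectProperty A) : ObjectProperty (Rep Q A) :=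
  fun F => ∀ i : Q, X (F.at i)

/-- `φ_i : ∐_{a : j ⟶ i} F(j) ⟶ F(i)`, the coproduct being over all arrows with target `i`. -/
def phi [HasCoproducts.{w} A] (F : Rep Q A) (i : Q) :
    (∐ fun a : Quiver.Costar i => F.at a.1) ⟶ F.at i :=
  Sigma.desc fun a => F.arrow a.2

/-- `ψ_i : F(i) ⟶ ∏_{a : i ⟶ j} F(j)`, the product being over all arrows with source `i`. -/
def psi [HasProducts.{w} A] (F : Rep Q A) (i : Q) :
    F.at i ⟶ (∏ᶜ fun a : Quiver.Star i => F.at a.1) :=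
  Pi.lift fun a => F.arrow a.2

variable [Abelian A]

/-- `Φ(X)`: the representations `F` such that, for all vertices `i`, `φ_i` is a monomorphism whose
cokernel belongs to `X`. -/
def Phi (Q : Type w) [Quiver.{w} Q] [HasCoproducts.{w} A] (X : ObjectProperty A) :
    ObjectProperty (Rep Q A) :=
  fun F => ∀ i : Q, Mono (phi F i) ∧ X (cokernel (phi F i))

/-- `Ψ(Y)`: the representations `F` such that, for all vertices `i`, `ψ_i` is an epimorphism whose
kernel belongs to `Y`. -/
def Psi (Q : Type w) [Quiver.{w} Q] [HasProducts.{w} A] (Y : ObjectProperty A) :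
    ObjectProperty (Rep Q A) :=
  fun F => ∀ i : Q, Epi (psi F i) ∧ Y (kernel (psi F i))

end Representations

end QuiverCotorsion

end

/-! A complete cotorsion pair amounts to a lifting and factorization calculus: monomorphisms with
cokernel in `X` lift against epimorphisms with kernel in `Y`, and every morphism factors as one of
the former followed by one of the latter (`exists_square_lift`, `exists_factorization`). Rootedness
makes the arrow relation on vertices well-founded, so both statements pass to representations by
recursion on vertices, as in the theory of Reedy categories.

To factor `F ⟶ G` at `i`, when the sources of arrows into `i` are already treated, one factors the
map to `G(i)` from the pushout of `φ_i^F` along the coproduct of the earlier left factors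
(`exists_factorization_latchingMap`). Factoring `0 ⟶ M` and `M ⟶ 0` yields the two approximations.
Exactness of coproducts identifies `φ_i` of a cokernel as a pushout of a relative latching map,
which places the cokernel in `Φ(X)` (`isMonoWith_phi_of_latchingMap`). Orthogonality is a recursive
lifting of sections (`nonempty_splitting_of_phi`).

All of this is run with the self-dual notion `IsApproximationPair`, so (b) follows from (a) through
the equivalence `opRep`. -/

noncomputable section

namespace QuiverCotorsion

/-! ### Vanishing of `Ext¹` in terms of extensions and lifting -/

section ExtOne

variable {C : Type u} [Category.{v} C] [Abelian C]

open DerivedCategory in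
/-- Elements of `Ext¹` are effaceable. -/
lemma exists_epi_comp_eq_zero [HasExt.{w} C] {M N : C} (ξ : Abelian.Ext.{w} M N 1) :
    ∃ (P : C) (p : P ⟶ M) (_ : Epi p), (Abelian.Ext.mk₀ p).comp ξ (zero_add 1) = 0 := by
  let := HasDerivedCategory.standard C
  -- The class as a morphism in the derived category from `M` in degree 0 to `N` in degree -1. It is
  -- a fraction `s⁻¹ g` whose middle complex lives in degrees at most 0; the cover of `M` is the
  -- degree 0 part of `s`.
  let f : Q.obj ((CochainComplex.singleFunctor C 0).obj M) ⟶
      Q.obj ((CochainComplex.singleFunctor C (-1)).obj N) :=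
    (singleFunctorIsoCompQ C 0).inv.app M ≫ ξ.hom ≫
      ((singleFunctors C).shiftIso 1 (-1) 0 (by simp)).hom.app N ≫
      (singleFunctorIsoCompQ C (-1)).hom.app N
  obtain ⟨X', _, s, _, g, fac⟩ := right_fac_of_isStrictlyLE f 0
  let p : X'.X 0 ⟶ M := s.f 0 ≫ (HomologicalComplex.singleObjXSelf (.up ℤ) 0 M).hom
  let j : (CochainComplex.singleFunctor C 0).obj (X'.X 0) ⟶ X' :=
    HomologicalComplex.mkHomFromSingle (𝟙 _)
      (fun k hk => (X'.isZero_of_isStrictlyLE 0 k (by simp at hk; lia)).eq_of_tgt _ _)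
  have hj : j ≫ s = (CochainComplex.singleFunctor C 0).map p := by
    apply HomologicalComplex.from_single_hom_ext
    refine (HomologicalComplex.comp_f _ _ _).trans
      (Eq.trans ?_ (HomologicalComplex.single_map_f_self (.up ℤ) 0 p).symm)
    rw [HomologicalComplex.mkHomFromSingle_f, Category.comp_id]
    exact congrArg (_ ≫ ·) ((Category.assoc _ _ _).trans
      ((congrArg (s.f 0 ≫ ·) (Iso.hom_inv_id _)).trans (Category.comp_id _))).symm
  have hg : j ≫ g = 0 := by
    apply HomologicalComplex.from_single_hom_ext
    exact (HomologicalComplex.isZero_single_obj_X (.up ℤ) (-1) N 0 (by simp)).eq_of_tgt _ _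
  -- Epi: maps out of `M` that agree after `p` agree after `s`, which is invertible in the derived
  -- category, and `singleFunctor` is faithful. Vanishing: `p` factors through `s` via `j`, and `j ≫
  -- g = 0` for degree reasons.
  refine ⟨X'.X 0, p, ⟨fun {T} a b hab => ?_⟩, ?_⟩
  · have hs : s ≫ (CochainComplex.singleFunctor C 0).map a =
        s ≫ (CochainComplex.singleFunctor C 0).map b := by
      apply HomologicalComplex.to_single_hom_ext
      refine (HomologicalComplex.comp_f _ _ _).trans
        (Eq.trans ?_ (HomologicalComplex.comp_f _ _ _).symm)
      refine (congrArg (s.f 0 ≫ ·) (HomologicalComplex.single_map_f_self (.up ℤ) 0 a)).trans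
        (Eq.trans ?_
          (congrArg (s.f 0 ≫ ·) (HomologicalComplex.single_map_f_self (.up ℤ) 0 b)).symm)
      have hab' := congrArg (· ≫ (HomologicalComplex.singleObjXSelf (.up ℤ) 0 T).inv) hab
      simp only [Category.assoc] at hab'
      exact (Category.assoc _ _ _).symm.trans (hab'.trans (Category.assoc _ _ _))
    have hQ := Q.congr_map hs
    rw [Functor.map_comp, Functor.map_comp, cancel_epi] at hQ
    apply (singleFunctor C 0).map_injective
    have ha := (singleFunctorIsoCompQ C 0).hom.naturality a
    have hb := (singleFunctorIsoCompQ C 0).hom.naturality b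
    dsimp only [Functor.comp_map] at ha hb
    rw [← cancel_mono ((singleFunctorIsoCompQ C 0).hom.app T), ha, hb, hQ]
  · have hf : Q.map ((CochainComplex.singleFunctor C 0).map p) ≫ f = 0 := by
      rw [← hj, fac, Functor.map_comp, Category.assoc, IsIso.hom_inv_id_assoc, ← Functor.map_comp,
        hg, Functor.map_zero]
    have hp := (singleFunctorIsoCompQ C 0).inv.naturality p
    dsimp only [Functor.comp_map] at hp
    ext
    rw [Abelian.Ext.comp_hom, Abelian.Ext.mk₀_hom, ShiftedHom.mk₀_comp, Abelian.Ext.zero_hom]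
    dsimp only [f] at hf
    rw [reassoc_of% hp] at hf
    rw [← cancel_epi ((singleFunctorIsoCompQ C 0).inv.app _), ← cancel_mono
      (((singleFunctors C).shiftIso 1 (-1) 0 (by simp)).hom.app N ≫
      (singleFunctorIsoCompQ C (-1)).hom.app N)]
    simpa using hf

lemma shortExact_of_isPushout {S : ShortComplex C} (hS : S.ShortExact) {N E : C}
    {k : S.X₁ ⟶ N} {q : S.X₂ ⟶ E} {i : N ⟶ E} (sq : IsPushout S.f k q i) {p : E ⟶ S.X₃}
    (hq : q ≫ p = S.g) (w : i ≫ p = 0) : (ShortComplex.mk i p w).ShortExact := by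
  have := hS.mono_f
  have := hS.epi_g
  have : Mono i := by
    have := sq.flip
    exact (MorphismProperty.monomorphisms C).of_isPushout this (.infer_property _)
  have : Epi p := epi_of_epi_fac hq
  refine ⟨?_⟩
  apply ShortComplex.exact_of_g_is_cokernel
  refine CokernelCofork.IsColimit.ofπ' _ _ fun {T} t ht => ?_
  have ht' : S.f ≫ q ≫ t = 0 := by
    rw [sq.w_assoc, ht, comp_zero]
  refine ⟨hS.exact.desc _ ht', ?_⟩
  apply sq.hom_ext
  · rw [reassoc_of% hq, hS.exact.g_desc]
  · rw [reassoc_of% w, zero_comp]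
    exact ht.symm

lemma exists_pushout_shortExact {S : ShortComplex C} (hS : S.ShortExact) {N : C}
    (k : S.X₁ ⟶ N) :
    ∃ (E : C) (i : N ⟶ E) (p : E ⟶ S.X₃) (w : i ≫ p = 0) (q : S.X₂ ⟶ E),
      (ShortComplex.mk i p w).ShortExact ∧ IsPushout S.f k q i ∧ q ≫ p = S.g := by
  have sq := IsPushout.of_hasPushout S.f k
  have h0 : S.f ≫ S.g = k ≫ 0 := by rw [S.zero, comp_zero]
  exact ⟨_, _, sq.desc S.g 0 h0, sq.inr_desc _ _ _, _,
    shortExact_of_isPushout hS sq (sq.inl_desc _ _ _) _, sq, sq.inl_desc _ _ _⟩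

/-- A map out of `T.X₂` whose restriction to `S.X₂` factors through `S.g` kills `T.X₁`, because
`φ.τ₁` is epi, and so descends to `T.X₃`. -/
lemma isPushout_of_shortExact_hom {S T : ShortComplex C} (hS : S.ShortExact) (hT : T.ShortExact)
    (φ : S ⟶ T) [Epi φ.τ₁] : IsPushout φ.τ₂ S.g T.g φ.τ₃ := by
  have := hS.epi_g
  have := hT.epi_g
  refine ⟨⟨φ.comm₂₃⟩, ⟨PushoutCocone.IsColimit.mk _ (fun s => hT.exact.desc s.inl ?_) ?_ ?_ ?_⟩⟩
  · rw [← cancel_epi φ.τ₁, φ.comm₁₂_assoc, s.condition, S.zero_assoc, zero_comp, comp_zero]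
  · intro s
    exact hT.exact.g_desc _ _
  · intro s
    rw [← cancel_epi S.g, ← φ.comm₂₃_assoc, hT.exact.g_desc, s.condition]
  · intro s m h₁ _
    rw [← cancel_epi T.g, h₁, hT.exact.g_desc]

lemma ExtOneVanishes.exists_extension {S : ShortComplex C} (hS : S.ShortExact) {N : C}
    (h : ExtOneVanishes S.X₃ N) (f : S.X₁ ⟶ N) : ∃ g : S.X₂ ⟶ N, S.f ≫ g = f := by
  have : HasExt.{max u v} C := HasExt.standard C
  have : Subsingleton (Abelian.Ext.{max u v} S.X₃ N 1) := h
  obtain ⟨x, hx⟩ := Abelian.Ext.contravariant_sequence_exact₁ hS N (Abelian.Ext.mk₀ f)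
    (add_zero 1) (Subsingleton.elim _ _)
  obtain ⟨g, rfl⟩ := Abelian.Ext.mk₀_bijective _ _ |>.2 x
  rw [Abelian.Ext.mk₀_comp_mk₀] at hx
  exact ⟨g, Abelian.Ext.mk₀_bijective _ _ |>.1 hx⟩

lemma ExtOneVanishes.nonempty_splitting {S : ShortComplex C} (hS : S.ShortExact)
    (h : ExtOneVanishes S.X₃ S.X₁) : Nonempty S.Splitting := by
  obtain ⟨r, hr⟩ := h.exists_extension hS (𝟙 _)
  exact ⟨ShortComplex.Splitting.ofExactOfRetraction S hS.exact r hr hS.epi_g⟩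

/-- A class effaced by `p : P ⟶ M` comes from a morphism `k : kernel p ⟶ N`, hence is the class of
the extension obtained by pushout along `k`; a retraction kills that class. -/
lemma extOneVanishes_of_retraction {M N : C}
    (h : ∀ (E : C) (i : N ⟶ E) (p : E ⟶ M) (w : i ≫ p = 0),
      (ShortComplex.mk i p w).ShortExact → ∃ r : E ⟶ N, i ≫ r = 𝟙 N) :
    ExtOneVanishes M N := by
  have : HasExt.{max u v} C := HasExt.standard C
  suffices ∀ ξ : Abelian.Ext.{max u v} M N 1, ξ = 0 from ⟨fun a b => by rw [this a, this b]⟩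
  intro ξ
  obtain ⟨P, p, _, hp⟩ := exists_epi_comp_eq_zero ξ
  have hS : (ShortComplex.mk (kernel.ι p) p (kernel.condition p)).ShortExact :=
    { exact := ShortComplex.exact_kernel p }
  obtain ⟨x, hx⟩ := Abelian.Ext.contravariant_sequence_exact₃ hS N ξ hp (add_zero 1)
  obtain ⟨k, rfl⟩ := Abelian.Ext.mk₀_bijective _ _ |>.2 x
  obtain ⟨E, i, π, w, q, hE, sq, hq⟩ := exists_pushout_shortExact hS k
  obtain ⟨r, hr⟩ := h E i π w hE
  let φ : ShortComplex.mk (kernel.ι p) p (kernel.condition p) ⟶ ShortComplex.mk i π w :=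
    { τ₁ := k, τ₂ := q, τ₃ := 𝟙 _, comm₁₂ := sq.w.symm, comm₂₃ := by simpa using hq }
  have h0 : hE.extClass = 0 := by
    have h1 : (Abelian.Ext.mk₀ i).comp (Abelian.Ext.mk₀ r) (add_zero 0) =
      Abelian.Ext.mk₀ (𝟙 N) := by rw [Abelian.Ext.mk₀_comp_mk₀, hr]
    have h2 := hE.extClass_comp_assoc (Abelian.Ext.mk₀ r) (h := add_zero 1)
    rw [← Abelian.Ext.comp_mk₀_id hE.extClass, ← h1]
    exact h2
  have := ShortComplex.ShortExact.extClass_naturality hS hE φ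
  rw [h0, Abelian.Ext.comp_zero] at this
  rw [← hx]
  exact this

lemma extOneVanishes_of_section {M N : C}
    (h : ∀ (E : C) (i : N ⟶ E) (p : E ⟶ M) (w : i ≫ p = 0),
      (ShortComplex.mk i p w).ShortExact → ∃ s : M ⟶ E, s ≫ p = 𝟙 M) :
    ExtOneVanishes M N := by
  refine extOneVanishes_of_retraction fun E i p w hS => ?_
  obtain ⟨s, hs⟩ := h E i p w hS
  exact ⟨_, (ShortComplex.Splitting.ofExactOfSection _ hS.exact s hs hS.mono_f).f_r⟩

/-- The obstruction to lifting `b` through `T.g` restricts to zero along `S.f`, hence vanishes. The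
resulting lift may miss `a` by a map into `T.X₁`, which extends along `S.f` and corrects it. -/
lemma ExtOneVanishes.exists_square_lift {S T : ShortComplex C} (hS : S.ShortExact)
    (hT : T.ShortExact) (h : ExtOneVanishes S.X₃ T.X₁) (a : S.X₁ ⟶ T.X₂) (b : S.X₂ ⟶ T.X₃)
    (sq : S.f ≫ b = a ≫ T.g) : ∃ l : S.X₂ ⟶ T.X₂, S.f ≫ l = a ∧ l ≫ T.g = b := by
  have : HasExt.{max u v} C := HasExt.standard C
  have : Subsingleton (Abelian.Ext.{max u v} S.X₃ T.X₁ 1) := h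
  have h0 : (Abelian.Ext.mk₀ S.f).comp
      ((Abelian.Ext.mk₀ b).comp hT.extClass (zero_add 1)) (zero_add 1) = 0 := by
    rw [Abelian.Ext.mk₀_comp_mk₀_assoc, sq, ← Abelian.Ext.mk₀_comp_mk₀_assoc,
      hT.comp_extClass, Abelian.Ext.comp_zero]
  obtain ⟨x, hx⟩ := Abelian.Ext.contravariant_sequence_exact₂ hS _ _ h0
  rw [Subsingleton.elim x 0, Abelian.Ext.comp_zero] at hx
  obtain ⟨y, hy⟩ := Abelian.Ext.covariant_sequence_exact₃ _ hT _ (zero_add 1) hx.symm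
  obtain ⟨g, rfl⟩ := Abelian.Ext.mk₀_bijective _ _ |>.2 y
  rw [Abelian.Ext.mk₀_comp_mk₀] at hy
  have hg := Abelian.Ext.mk₀_bijective _ _ |>.1 hy
  have := hT.mono_f
  have hd : (a - S.f ≫ g) ≫ T.g = 0 := by
    rw [Preadditive.sub_comp, Category.assoc, hg, sq, sub_self]
  obtain ⟨d, hd'⟩ := h.exists_extension hS (hT.exact.lift _ hd)
  refine ⟨g + d ≫ T.f, ?_, ?_⟩
  · rw [Preadditive.comp_add, reassoc_of% hd', hT.exact.lift_f, add_sub_cancel]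
  · rw [Preadditive.add_comp, Category.assoc, T.zero, comp_zero, add_zero, hg]

end ExtOne

/-! ### Complete cotorsion pairs as approximation pairs -/

section Approximation

variable {C : Type u} [Category.{v} C] [Abelian C]

lemma ExtOneVanishes.of_retract_left {M P N : C} (r : Retract M P) (h : ExtOneVanishes P N) :
    ExtOneVanishes M N := by
  have : HasExt.{max u v} C := HasExt.standard C
  have : Subsingleton (Abelian.Ext.{max u v} P N 1) := h
  suffices ∀ ξ : Abelian.Ext.{max u v} M N 1, ξ = 0 from ⟨fun a b => by rw [this a, this b]⟩
  intro ξ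
  rw [← Abelian.Ext.mk₀_id_comp ξ, ← r.retract, ← Abelian.Ext.mk₀_comp_mk₀_assoc,
    Subsingleton.elim ((Abelian.Ext.mk₀ r.r).comp ξ (zero_add 1)) 0, Abelian.Ext.comp_zero]

lemma ExtOneVanishes.of_retract_right {M N P : C} (r : Retract N P) (h : ExtOneVanishes M P) :
    ExtOneVanishes M N := by
  have : HasExt.{max u v} C := HasExt.standard C
  have : Subsingleton (Abelian.Ext.{max u v} M P 1) := h
  suffices ∀ ξ : Abelian.Ext.{max u v} M N 1, ξ = 0 from ⟨fun a b => by rw [this a, this b]⟩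
  intro ξ
  rw [← Abelian.Ext.comp_mk₀_id ξ, ← r.retract, ← Abelian.Ext.mk₀_comp_mk₀,
    ← Abelian.Ext.comp_assoc_of_third_deg_zero,
    Subsingleton.elim (ξ.comp (Abelian.Ext.mk₀ r.i) (add_zero 1)) 0, Abelian.Ext.zero_comp]

instance (X : ObjectProperty C) : (leftPerp X).IsStableUnderRetracts where
  of_retract r h P hP := (h P hP).of_retract_left r

instance (X : ObjectProperty C) : (rightPerp X).IsStableUnderRetracts where
  of_retract r h P hP := (h P hP).of_retract_right r

/-- A self-dual reformulation of complete cotorsion pairs, which avoids `Ext`-groups and chosen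
kernels and cokernels. -/
structure IsApproximationPair (X Y : ObjectProperty C) : Prop where
  splitting (S : ShortComplex C) (hS : S.ShortExact) (h₃ : X S.X₃) (h₁ : Y S.X₁) :
    Nonempty S.Splitting
  precover (M : C) : ∃ S : ShortComplex C, S.ShortExact ∧ Y S.X₁ ∧ X S.X₂ ∧ Nonempty (S.X₃ ≅ M)
  preenvelope (M : C) :
    ∃ S : ShortComplex C, S.ShortExact ∧ X S.X₃ ∧ Y S.X₂ ∧ Nonempty (S.X₁ ≅ M)
  retract_left : X.IsStableUnderRetracts
  retract_right : Y.IsStableUnderRetracts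

namespace IsApproximationPair

variable {X Y : ObjectProperty C}

lemma exists_precover (h : IsApproximationPair X Y) (M : C) :
    ∃ (K P : C) (i : K ⟶ P) (p : P ⟶ M) (w : i ≫ p = 0),
      (ShortComplex.mk i p w).ShortExact ∧ Y K ∧ X P := by
  obtain ⟨S, hS, h₁, h₂, ⟨e⟩⟩ := h.precover M
  refine ⟨S.X₁, S.X₂, S.f, S.g ≫ e.hom, by rw [S.zero_assoc, zero_comp], ?_, h₁, h₂⟩
  exact ShortComplex.shortExact_of_iso
    (ShortComplex.isoMk (S₁ := S) (Iso.refl _) (Iso.refl _) e (by simp) (by simp)) hS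

lemma exists_preenvelope (h : IsApproximationPair X Y) (M : C) :
    ∃ (P Z : C) (i : M ⟶ P) (p : P ⟶ Z) (w : i ≫ p = 0),
      (ShortComplex.mk i p w).ShortExact ∧ Y P ∧ X Z := by
  obtain ⟨S, hS, h₃, h₂, ⟨e⟩⟩ := h.preenvelope M
  refine ⟨S.X₂, S.X₃, e.inv ≫ S.f, S.g, by rw [Category.assoc, S.zero, comp_zero], ?_, h₂, h₃⟩
  exact ShortComplex.shortExact_of_iso
    (ShortComplex.isoMk e (Iso.refl _) (Iso.refl _) (by simp) (by simp)) hS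

lemma extOneVanishes (h : IsApproximationPair X Y) {M N : C} (hM : X M) (hN : Y N) :
    ExtOneVanishes M N :=
  extOneVanishes_of_retraction fun _ _ _ _ hS =>
    let ⟨s⟩ := h.splitting _ hS hM hN
    ⟨s.r, s.f_r⟩

/-- If `N` is orthogonal to `X`, its special preenvelope splits, so `N` is a retract of an object of
`Y`. -/
lemma rightPerp_eq (h : IsApproximationPair X Y) : rightPerp X = Y := by
  ext N
  refine ⟨fun hN => ?_, fun hN M hM => h.extOneVanishes hM hN⟩
  obtain ⟨P, Z, i, p, w, hS, hP, hZ⟩ := h.exists_preenvelope N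
  obtain ⟨s⟩ := (hN Z hZ).nonempty_splitting hS
  have := h.retract_right
  exact Y.prop_of_retract ⟨i, s.r, s.f_r⟩ hP

lemma leftPerp_eq (h : IsApproximationPair X Y) : leftPerp Y = X := by
  ext M
  refine ⟨fun hM => ?_, fun hM N hN => h.extOneVanishes hM hN⟩
  obtain ⟨K, P, i, p, w, hS, hK, hP⟩ := h.exists_precover M
  obtain ⟨s⟩ := (hM K hK).nonempty_splitting hS
  have := h.retract_left
  exact X.prop_of_retract ⟨s.s, p, s.s_g⟩ hP

lemma isCompleteCotorsionPair (h : IsApproximationPair X Y) : IsCompleteCotorsionPair X Y where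
  rightPerp_eq := h.rightPerp_eq
  leftPerp_eq := h.leftPerp_eq
  enough_projectives M := by
    obtain ⟨K, P, i, p, w, hS, hK, hP⟩ := h.exists_precover M
    refine ⟨P, p, hS.epi_g, hP, ?_⟩
    have := h.retract_right
    have := hS.mono_f
    rw [h.rightPerp_eq]
    exact Y.prop_of_iso (IsLimit.conePointUniqueUpToIso hS.exact.fIsKernel (limit.isLimit _)) hK
  enough_injectives M := by
    obtain ⟨P, Z, i, p, w, hS, hP, hZ⟩ := h.exists_preenvelope M
    refine ⟨P, i, hS.mono_f, hP, ?_⟩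
    have := h.retract_left
    have := hS.epi_g
    rw [h.leftPerp_eq]
    exact X.prop_of_iso
      (IsColimit.coconePointUniqueUpToIso hS.exact.gIsCokernel (colimit.isColimit _)) hZ

protected lemma op (h : IsApproximationPair X Y) : IsApproximationPair Y.op X.op where
  splitting S hS h₃ h₁ := by
    obtain ⟨s⟩ := h.splitting S.unop hS.unop h₁ h₃
    exact ⟨s.op⟩
  precover M := by
    obtain ⟨S, hS, h₃, h₂, ⟨e⟩⟩ := h.preenvelope M.unop
    exact ⟨S.op, hS.op, h₃, h₂, ⟨e.op.symm⟩⟩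
  preenvelope M := by
    obtain ⟨S, hS, h₁, h₂, ⟨e⟩⟩ := h.precover M.unop
    exact ⟨S.op, hS.op, h₁, h₂, ⟨e.op.symm⟩⟩
  retract_left :=
    have := h.retract_right
    ⟨fun r h => Y.prop_of_retract ⟨r.r.unop, r.i.unop, congrArg Quiver.Hom.unop r.retract⟩ h⟩
  retract_right :=
    have := h.retract_left
    ⟨fun r h => X.prop_of_retract ⟨r.r.unop, r.i.unop, congrArg Quiver.Hom.unop r.retract⟩ h⟩

lemma inverseImage {D : Type*} [Category* D] [Abelian D] (h : IsApproximationPair X Y)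
    (F : D ⥤ C) [F.IsEquivalence] : IsApproximationPair (X.inverseImage F) (Y.inverseImage F) where
  splitting S hS h₃ h₁ := by
    obtain ⟨s⟩ := h.splitting (S.map F) (hS.map_of_exact F) h₃ h₁
    let r : F.obj S.X₂ ⟶ F.obj S.X₁ := s.r
    refine ⟨ShortComplex.Splitting.ofExactOfRetraction S hS.exact (F.preimage r)
      (F.map_injective ?_) hS.epi_g⟩
    rw [F.map_comp, F.map_preimage, F.map_id]
    exact s.f_r
  precover M := by
    obtain ⟨S, hS, h₁, h₂, ⟨e⟩⟩ := h.precover (F.obj M)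
    have := h.retract_left
    have := h.retract_right
    exact ⟨S.map F.inv, hS.map_of_exact F.inv,
      Y.prop_of_iso (F.asEquivalence.counitIso.app _).symm h₁,
      X.prop_of_iso (F.asEquivalence.counitIso.app _).symm h₂,
      ⟨F.inv.mapIso e ≪≫ (F.asEquivalence.unitIso.app _).symm⟩⟩
  preenvelope M := by
    obtain ⟨S, hS, h₁, h₂, ⟨e⟩⟩ := h.preenvelope (F.obj M)
    have := h.retract_left
    have := h.retract_right
    exact ⟨S.map F.inv, hS.map_of_exact F.inv,
      X.prop_of_iso (F.asEquivalence.counitIso.app _).symm h₁,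
      Y.prop_of_iso (F.asEquivalence.counitIso.app _).symm h₂,
      ⟨F.inv.mapIso e ≪≫ (F.asEquivalence.unitIso.app _).symm⟩⟩
  retract_left :=
    have := h.retract_left
    ⟨fun r h => X.prop_of_retract (r.map F) h⟩
  retract_right :=
    have := h.retract_right
    ⟨fun r h => Y.prop_of_retract (r.map F) h⟩

end IsApproximationPair

lemma IsCompleteCotorsionPair.isApproximationPair {X Y : ObjectProperty C}
    (h : IsCompleteCotorsionPair X Y) : IsApproximationPair X Y where
  splitting S hS h₃ h₁ := by
    rw [← h.leftPerp_eq] at h₃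
    exact (h₃ _ h₁).nonempty_splitting hS
  precover M := by
    obtain ⟨P, f, hf⟩ := h.enough_projectives M
    have := hf.epi
    refine ⟨ShortComplex.mk _ f (kernel.condition f), { exact := ShortComplex.exact_kernel f },
      ?_, hf.mem, ⟨Iso.refl _⟩⟩
    have := hf.kernel_mem
    rwa [h.rightPerp_eq] at this
  preenvelope M := by
    obtain ⟨P, f, hf⟩ := h.enough_injectives M
    have := hf.mono
    refine ⟨ShortComplex.mk f _ (cokernel.condition f), { exact := ShortComplex.exact_cokernel f },
      ?_, hf.mem, ⟨Iso.refl _⟩⟩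
    have := hf.cokernel_mem
    rwa [h.leftPerp_eq] at this
  retract_left := by rw [← h.leftPerp_eq]; infer_instance
  retract_right := by rw [← h.rightPerp_eq]; infer_instance

end Approximation

/-! ### The lifting and factorization calculus of a cotorsion pair -/

section Factorization

variable {C : Type u} [Category.{v} C] [Abelian C]

/-- Lets results about cokernels be applied to `N` itself, seen as the cokernel of a map from zero.
-/
lemma shortExact_id_right {M N : C} (hM : IsZero M) (f : M ⟶ N) :
    (ShortComplex.mk f (𝟙 N) (hM.eq_of_src _ _)).ShortExact where
  exact := (ShortComplex.exact_iff_mono _ (hM.eq_of_src _ _)).2 (inferInstanceAs (Mono (𝟙 N)))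
  mono_f := ⟨fun _ _ _ => hM.eq_of_tgt _ _⟩
  epi_g := inferInstanceAs (Epi (𝟙 N))

lemma shortExact_id_left {M N : C} (hN : IsZero N) (f : M ⟶ N) :
    (ShortComplex.mk (𝟙 M) f (hN.eq_of_tgt _ _)).ShortExact where
  exact := (ShortComplex.exact_iff_epi _ (hN.eq_of_tgt _ _)).2 (inferInstanceAs (Epi (𝟙 M)))
  mono_f := inferInstanceAs (Mono (𝟙 M))
  epi_g := ⟨fun _ _ _ => hN.eq_of_src _ _⟩

/-- `f` is a monomorphism with cokernel in `X`. -/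
def IsMonoWith (X : ObjectProperty C) {M N : C} (f : M ⟶ N) : Prop :=
  ∃ (Z : C) (p : N ⟶ Z) (w : f ≫ p = 0), (ShortComplex.mk f p w).ShortExact ∧ X Z

/-- `f` is an epimorphism with kernel in `Y`. -/
def IsEpiWith (Y : ObjectProperty C) {M N : C} (f : M ⟶ N) : Prop :=
  ∃ (K : C) (i : K ⟶ M) (w : i ≫ f = 0), (ShortComplex.mk i f w).ShortExact ∧ Y K

lemma IsMonoWith.mono {X : ObjectProperty C} {M N : C} {f : M ⟶ N} (h : IsMonoWith X f) :
    Mono f := by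
  obtain ⟨_, _, _, h, _⟩ := h
  exact h.mono_f

lemma IsEpiWith.epi {Y : ObjectProperty C} {M N : C} {f : M ⟶ N} (h : IsEpiWith Y f) :
    Epi f := by
  obtain ⟨_, _, _, h, _⟩ := h
  exact h.epi_g

lemma IsMonoWith.prop_X₃ {X : ObjectProperty C} [X.IsClosedUnderIsomorphisms]
    {S : ShortComplex C} (hS : S.ShortExact) (h : IsMonoWith X S.f) : X S.X₃ := by
  obtain ⟨Z, p, w, hp, hZ⟩ := h
  have := hS.epi_g
  have := hp.epi_g
  exact X.prop_of_iso
    (IsColimit.coconePointUniqueUpToIso hp.exact.gIsCokernel hS.exact.gIsCokernel) hZ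

lemma IsEpiWith.prop_X₁ {Y : ObjectProperty C} [Y.IsClosedUnderIsomorphisms]
    {S : ShortComplex C} (hS : S.ShortExact) (h : IsEpiWith Y S.g) : Y S.X₁ := by
  obtain ⟨K, i, w, hi, hK⟩ := h
  have := hS.mono_f
  have := hi.mono_f
  exact Y.prop_of_iso
    (IsLimit.conePointUniqueUpToIso hi.exact.fIsKernel hS.exact.fIsKernel) hK

lemma isMonoWith_iff {X : ObjectProperty C} [X.IsClosedUnderIsomorphisms] {M N : C} (f : M ⟶ N) :
    IsMonoWith X f ↔ Mono f ∧ X (cokernel f) := by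
  refine ⟨fun h => ⟨h.mono, ?_⟩, fun ⟨_, h⟩ => ?_⟩
  · have := h.mono
    exact h.prop_X₃ (S := .mk f _ (cokernel.condition f))
      { exact := ShortComplex.exact_cokernel f }
  · exact ⟨_, _, cokernel.condition f, { exact := ShortComplex.exact_cokernel f }, h⟩

lemma IsMonoWith.of_isPushout {X : ObjectProperty C} {M N M' N' : C} {f : M ⟶ N} {k : M ⟶ M'}
    {q : N ⟶ N'} {f' : M' ⟶ N'} (h : IsMonoWith X f) (sq : IsPushout f k q f') :
    IsMonoWith X f' := by
  obtain ⟨Z, p, w, hp, hZ⟩ := h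
  have h0 : f ≫ p = k ≫ 0 := by rw [w, comp_zero]
  exact ⟨Z, sq.desc p 0 h0, sq.inr_desc _ _ _,
    shortExact_of_isPushout hp sq (sq.inl_desc _ _ _) _, hZ⟩

lemma isMonoWith_biprod_inl {X : ObjectProperty C} (M : C) {P : C} (hP : X P) :
    IsMonoWith X (biprod.inl : M ⟶ M ⊞ P) :=
  ⟨P, biprod.snd, biprod.inl_snd, (ShortComplex.Splitting.ofHasBinaryBiproduct M P).shortExact, hP⟩

namespace IsApproximationPair

variable {X Y : ObjectProperty C} (h : IsApproximationPair X Y)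
include h

lemma exists_square_lift {M N E F : C} {f : M ⟶ N} {p : E ⟶ F} (hf : IsMonoWith X f)
    (hp : IsEpiWith Y p) (a : M ⟶ E) (b : N ⟶ F) (sq : f ≫ b = a ≫ p) :
    ∃ l : N ⟶ E, f ≫ l = a ∧ l ≫ p = b := by
  obtain ⟨Z, q, _, hq, hZ⟩ := hf
  obtain ⟨K, i, _, hi, hK⟩ := hp
  exact (h.extOneVanishes hZ hK).exists_square_lift hq hi a b sq

/-- Given an extension of `cokernel f` by an object of `Y`, lifting `cokernel.π f` against it, with
zero on `M`, gives a section. So the cokernel lies in `leftPerp Y`. -/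
lemma isMonoWith_of_exists_square_lift {M N : C} (f : M ⟶ N) [Mono f]
    (hf : ∀ {E F : C} {p : E ⟶ F} (_ : IsEpiWith Y p) (a : M ⟶ E) (b : N ⟶ F),
      f ≫ b = a ≫ p → ∃ l : N ⟶ E, f ≫ l = a ∧ l ≫ p = b) : IsMonoWith X f := by
  refine ⟨_, _, cokernel.condition f, { exact := ShortComplex.exact_cokernel f }, ?_⟩
  rw [← h.leftPerp_eq]
  refine fun K hK => extOneVanishes_of_section fun E i p w hS => ?_
  obtain ⟨l, hl, hl'⟩ := hf ⟨K, i, w, hS, hK⟩ 0 (cokernel.π f) (by simp)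
  exact ⟨cokernel.desc f l hl, by rw [← cancel_epi (cokernel.π f)]; simpa using hl'⟩

lemma isMonoWith_comp {M N P : C} {f : M ⟶ N} {g : N ⟶ P} (hf : IsMonoWith X f)
    (hg : IsMonoWith X g) : IsMonoWith X (f ≫ g) := by
  have := hf.mono
  have := hg.mono
  refine h.isMonoWith_of_exists_square_lift _ fun hp a b sq => ?_
  obtain ⟨l, hl, hl'⟩ := h.exists_square_lift hf hp a (g ≫ b) (by simpa using sq)
  obtain ⟨m, hm, hm'⟩ := h.exists_square_lift hg hp l b hl'.symm
  exact ⟨m, by rw [Category.assoc, hm, hl], hm'⟩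

/-- Push out the kernel sequence of `f` along a special preenvelope of the kernel: the new kernel is
the preenvelope, and `M ⟶ E` inherits its cokernel. -/
lemma exists_factorization_of_epi {M N : C} (f : M ⟶ N) [Epi f] :
    ∃ (E : C) (i : M ⟶ E) (p : E ⟶ N), IsMonoWith X i ∧ IsEpiWith Y p ∧ i ≫ p = f := by
  obtain ⟨P, Z, k, q, w, hk, hP, hZ⟩ := h.exists_preenvelope (kernel f)
  obtain ⟨E, j, p, w', i, hE, sq, hp⟩ :=
    exists_pushout_shortExact (S := .mk _ f (kernel.condition f))
      { exact := ShortComplex.exact_kernel f } k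
  exact ⟨E, i, p, IsMonoWith.of_isPushout ⟨Z, q, w, hk, hZ⟩ sq.flip, ⟨P, j, w', hE, hP⟩, hp⟩

/-- The factorization of a morphism attached to a complete cotorsion pair. -/
lemma exists_factorization {M N : C} (f : M ⟶ N) :
    ∃ (E : C) (i : M ⟶ E) (p : E ⟶ N), IsMonoWith X i ∧ IsEpiWith Y p ∧ i ≫ p = f := by
  obtain ⟨K, P, i, p, w, hp, hK, hP⟩ := h.exists_precover N
  have := hp.epi_g
  -- Adding a precover of `N` to the source reduces to the epi case, at the cost of an inclusion
  -- with cokernel in `X`.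
  have : Epi (biprod.desc f p) := epi_of_epi_fac (biprod.inr_desc f p)
  obtain ⟨E, j, q, hj, hq, fac⟩ := h.exists_factorization_of_epi (biprod.desc f p)
  exact ⟨E, biprod.inl ≫ j, q, h.isMonoWith_comp (isMonoWith_biprod_inl M hP) hj, hq,
    by rw [Category.assoc, fac, biprod.inl_desc]⟩

end IsApproximationPair

end Factorization

/-! ### Rootedness and well-founded recursion -/

section Rooted

variable (Q : Type w) [Quiver.{w} Q]

/-- The relation on vertices given by the existence of an arrow. -/
abbrev arrowRel (j i : Q) : Prop := Nonempty (j ⟶ i)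

/-- At a nonlimit stage every arrow into `i` starts at a vertex of an earlier stage; a limit stage
adds no vertices. -/
lemma acc_of_mem_rootedSeq (α : Ordinal.{w}) : ∀ i ∈ rootedSeq Q α, Acc (arrowRel Q) i := by
  induction α using WellFoundedLT.induction with
  | ind α ih =>
    intro i hi
    rw [rootedSeq] at hi
    rcases hi with ⟨_, β, hβ⟩ | ⟨_, _, hi⟩
    · exact ih β.1 β.2 i hβ
    · refine Acc.intro i fun j ⟨a⟩ => ?_
      obtain ⟨β, hβ⟩ := hi j a
      exact ih β.1 β.2 j hβ

variable {Q} in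
lemma IsLeftRooted.wellFounded (h : IsLeftRooted Q) : WellFounded (arrowRel Q) := by
  obtain ⟨l, hl⟩ := h
  exact ⟨fun i => acc_of_mem_rootedSeq Q l i (hl ▸ Set.mem_univ i)⟩

end Rooted

/-- Recursive choice along a well-founded relation. -/
lemma exists_forall_of_wellFounded {ι : Sort*} {r : ι → ι → Prop} (hr : WellFounded r)
    {D : ι → Sort*} (R : ∀ i, (∀ j, r j i → D j) → D i → Prop) (h : ∀ i d, ∃ x, R i d x) :
    ∃ d : ∀ i, D i, ∀ i, R i (fun j _ => d j) (d i) := by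
  choose c hc using h
  refine ⟨hr.fix c, fun i => ?_⟩
  -- Only the value at `i` is unfolded; the values at its predecessors stay folded.
  conv => arg 3; rw [hr.fix_eq]
  exact hc _ _

/-! ### Morphisms of representations and naturality of `φ` -/

section Representations

variable {Q : Type w} [Quiver.{w} Q] {A : Type u} [Category.{v} A]

lemma Rep.naturality_of_arrow {F G : Rep Q A} (φ : ∀ i : Paths Q, F.obj i ⟶ G.obj i)
    (h : ∀ {i j : Q} (a : i ⟶ j),
      F.arrow a ≫ φ ((Paths.of Q).obj j) = φ ((Paths.of Q).obj i) ≫ G.arrow a)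
    {i j : Paths Q} (f : i ⟶ j) : F.map f ≫ φ j = φ i ≫ G.map f := by
  induction f using Paths.induction with
  | id => rw [F.map_id, G.map_id, Category.id_comp, Category.comp_id]
  | comp p a ih => rw [F.map_comp, G.map_comp, Category.assoc, ← reassoc_of% ih, h a]

/-- A family of morphisms at the vertices which is compatible with the arrows is a morphism of
representations. -/
def Rep.homMk {F G : Rep Q A} (φ : ∀ i : Q, F.at i ⟶ G.at i)
    (h : ∀ {i j : Q} (a : i ⟶ j), F.arrow a ≫ φ j = φ i ≫ G.arrow a) : F ⟶ G where
  app i := φ i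
  naturality _ _ f := Rep.naturality_of_arrow (fun i => φ i) h f

/-- The morphism at a vertex of a morphism of representations. -/
abbrev Rep.appAt {F G : Rep Q A} (η : F ⟶ G) (i : Q) : F.at i ⟶ G.at i :=
  η.app ((Paths.of Q).obj i)

lemma Rep.hom_ext {F G : Rep Q A} {η θ : F ⟶ G} (h : ∀ i, Rep.appAt η i = Rep.appAt θ i) :
    η = θ :=
  NatTrans.ext (funext h)

lemma Rep.lift_arrow (φ : Q ⥤q A) {i j : Q} (a : i ⟶ j) :
    Rep.arrow (Paths.lift φ) a = φ.map a :=
  Paths.lift_toPath φ a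

lemma Rep.mono_of_mono_appAt {F G : Rep Q A} (η : F ⟶ G) (h : ∀ i, Mono (Rep.appAt η i)) :
    Mono η :=
  have (i : Paths Q) : Mono (η.app i) := h i
  NatTrans.mono_of_mono_app η

lemma Rep.epi_of_epi_appAt {F G : Rep Q A} (η : F ⟶ G) (h : ∀ i, Epi (Rep.appAt η i)) :
    Epi η :=
  have (i : Paths Q) : Epi (η.app i) := h i
  NatTrans.epi_of_epi_app η

section Phi

variable [HasCoproducts.{w} A]

lemma ι_phi (F : Rep Q A) {i : Q} (a : Quiver.Costar i) :
    Sigma.ι (fun a : Quiver.Costar i => F.at a.1) a ≫ phi F i = F.arrow a.2 :=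
  Sigma.ι_desc _ _

/-- The coproduct of the morphisms at the sources of the arrows with target `i`. -/
abbrev sigmaAt {F G : Rep Q A} (η : F ⟶ G) (i : Q) :
    (∐ fun a : Quiver.Costar i => F.at a.1) ⟶ ∐ fun a : Quiver.Costar i => G.at a.1 :=
  Limits.Sigma.map fun a => Rep.appAt η a.1

lemma phi_naturality {F G : Rep Q A} (η : F ⟶ G) (i : Q) :
    phi F i ≫ Rep.appAt η i = sigmaAt η i ≫ phi G i := by
  apply Sigma.hom_ext
  intro a
  rw [reassoc_of% ι_phi F a, Sigma.ι_map_assoc, ι_phi, η.naturality]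

lemma retract_phi {F G : Rep Q A} (r : Retract F G) (i : Q) :
    Nonempty (RetractArrow (phi F i) (phi G i)) :=
  ⟨{  i := Arrow.homMk (sigmaAt r.i i) (Rep.appAt r.i i) (phi_naturality _ _).symm
      r := Arrow.homMk (sigmaAt r.r i) (Rep.appAt r.r i) (phi_naturality _ _).symm
      retract := by
        have (j : Q) : Rep.appAt r.i j ≫ Rep.appAt r.r j = 𝟙 _ :=
          congrArg (fun η => Rep.appAt η j) r.retract
        ext
        · change sigmaAt r.i i ≫ sigmaAt r.r i = 𝟙 _
          apply Sigma.hom_ext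
          intro a
          rw [Sigma.ι_map_assoc, Sigma.ι_map, reassoc_of% this, Category.comp_id]
        · exact this i }⟩

end Phi
end Representations

/-! ### Exactness of coproducts -/

section Coproducts

variable {A : Type u} [Category.{v} A] [Abelian A] [HasCoproducts.{w} A]

variable (A) in
/-- Coproducts of monomorphisms are monomorphisms. -/
def MonoSigmaMap : Prop :=
  ∀ (J : Type w) (f g : J → A) (φ : ∀ j, f j ⟶ g j), (∀ j, Mono (φ j)) → Mono (Limits.Sigma.map φ)

variable (A) in
lemma monoSigmaMap_of_AB4 [AB4OfSize.{w} A] : MonoSigmaMap.{w} A := by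
  intro J f g φ hφ
  let α : Discrete.functor f ⟶ Discrete.functor g := Discrete.natTrans fun j => φ j.as
  have : ∀ j, Mono (α.app j) := fun j => hφ j.as
  have : Mono α := NatTrans.mono_of_mono_app α
  exact inferInstanceAs (Mono (colim.map α))

lemma sigmaMap_comp_eq_zero {J : Type w} {M N P : J → A} (f : ∀ j, M j ⟶ N j)
    (g : ∀ j, N j ⟶ P j) (w : ∀ j, f j ≫ g j = 0) :
    Limits.Sigma.map f ≫ Limits.Sigma.map g = 0 := by
  refine Sigma.hom_ext _ _ fun j => ?_
  rw [Sigma.ι_map_assoc, Sigma.ι_map, reassoc_of% w, zero_comp, comp_zero]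

/-- Coproducts always preserve cokernels; `hA` is needed only on the left. -/
lemma shortExact_sigma (hA : MonoSigmaMap.{w} A) {J : Type w} {M N P : J → A} (f : ∀ j, M j ⟶ N j)
    (g : ∀ j, N j ⟶ P j) (w : ∀ j, f j ≫ g j = 0)
    (h : ∀ j, (ShortComplex.mk (f j) (g j) (w j)).ShortExact) :
    (ShortComplex.mk (Limits.Sigma.map f) (Limits.Sigma.map g)
      (sigmaMap_comp_eq_zero f g w)).ShortExact := by
  have := hA J M N f fun j => (h j).mono_f
  have he (j : J) : Epi (g j) := (h j).epi_g
  have : Epi (Limits.Sigma.map g) := by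
    refine ⟨fun a b hab => Sigma.hom_ext _ _ fun j => ?_⟩
    rw [← cancel_epi (g j), ← Sigma.ι_map_assoc, ← Sigma.ι_map_assoc, hab]
  refine ⟨?_⟩
  apply ShortComplex.exact_of_g_is_cokernel
  refine CokernelCofork.IsColimit.ofπ' _ _ fun {T} t ht => ?_
  have ht' (j : J) : f j ≫ Sigma.ι N j ≫ t = 0 := by
    rw [← Sigma.ι_map_assoc, ht, comp_zero]
  refine ⟨Sigma.desc fun j => (h j).exact.desc _ (ht' j), Sigma.hom_ext _ _ fun j => ?_⟩
  rw [Sigma.ι_map_assoc, Sigma.ι_desc]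
  exact (h j).exact.g_desc _ _

end Coproducts

/-! ### Latching maps and the cotorsion pair `(Φ(X), Rep(Q, Y))` -/

section Representations

variable {Q : Type w} [Quiver.{w} Q] {A : Type u} [Category.{v} A] [Abelian A]

lemma shortExact_at {S : ShortComplex (Rep Q A)} (hS : S.ShortExact) (i : Q) :
    (ShortComplex.mk (Rep.appAt S.f i) (Rep.appAt S.g i)
      (congrArg (fun η => Rep.appAt η i) S.zero)).ShortExact :=
  hS.map_of_exact ((evaluation (Paths Q) A).obj ((Paths.of Q).obj i))

variable [HasCoproducts.{w} A]

/-- The relative latching morphism at a vertex of a morphism of representations. -/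
def latchingMap {F G : Rep Q A} (η : F ⟶ G) (i : Q) :
    pushout (phi F i) (sigmaAt η i) ⟶ G.at i :=
  pushout.desc (Rep.appAt η i) (phi G i) (phi_naturality η i)

/-- The component at `i` is the latching map after a pushout of `sigmaAt η i`, which is mono by
induction and `hA`. -/
lemma mono_appAt_of_latchingMap (hA : MonoSigmaMap.{w} A) (hQ : WellFounded (arrowRel Q))
    {F G : Rep Q A} (η : F ⟶ G) (h : ∀ i, Mono (latchingMap η i)) (i : Q) :
    Mono (Rep.appAt η i) := by
  induction i using hQ.induction with
  | h i ih =>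
    have := hA _ _ _ (fun a : Quiver.Costar i => Rep.appAt η a.1) fun a => ih a.1 ⟨a.2⟩
    have := h i
    have : pushout.inl (phi F i) (sigmaAt η i) ≫ latchingMap η i = Rep.appAt η i :=
      pushout.inl_desc _ _ _
    rw [← this]
    infer_instance

/-- If the relative latching morphisms of `S.f` are monomorphisms with cokernel in `X`, then the
cokernel of `S.f` belongs to `Φ(X)`. -/
lemma isMonoWith_phi_of_latchingMap {X : ObjectProperty A}
    (hA : MonoSigmaMap.{w} A) {S : ShortComplex (Rep Q A)} (hS : S.ShortExact) (i : Q)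
    (h : IsMonoWith X (latchingMap S.f i)) : IsMonoWith X (phi S.X₃ i) := by
  have hσ := shortExact_sigma hA (fun a : Quiver.Costar i => Rep.appAt S.f a.1)
    (fun a => Rep.appAt S.g a.1) _ fun a => shortExact_at hS a.1
  have sq := (IsPushout.of_hasPushout (phi S.X₁ i) (sigmaAt S.f i)).flip
  have h0 : sigmaAt S.f i ≫ sigmaAt S.g i = phi S.X₁ i ≫ 0 := by
    rw [comp_zero]
    exact sigmaMap_comp_eq_zero _ _ fun a : Quiver.Costar i =>
      congrArg (fun η => Rep.appAt η a.1) S.zero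
  have hD := shortExact_of_isPushout hσ sq (sq.inl_desc _ _ h0) (sq.inr_desc _ _ h0)
  -- A map of short exact sequences that is the identity on the left terms, so its right square is a
  -- pushout: `phi S.X₃ i` is a cobase change of the latching map.
  let ψ : ShortComplex.mk _ _ (sq.inr_desc _ _ h0) ⟶
      ShortComplex.mk (Rep.appAt S.f i) (Rep.appAt S.g i)
        (congrArg (fun η => Rep.appAt η i) S.zero) :=
    { τ₁ := 𝟙 _
      τ₂ := latchingMap S.f i
      τ₃ := phi S.X₃ i
      comm₁₂ := (Category.id_comp _).trans (pushout.inl_desc _ _ _).symm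
      comm₂₃ := by
        apply sq.hom_ext
        · rw [sq.inl_desc_assoc]
          exact (pushout.inr_desc_assoc _ _ _ _).trans (phi_naturality S.g i)
        · rw [sq.inr_desc_assoc, zero_comp]
          exact (pushout.inl_desc_assoc _ _ _ _).trans
            (congrArg (fun η => Rep.appAt η i) S.zero) }
  have : Epi ψ.τ₁ := inferInstanceAs (Epi (𝟙 _))
  exact h.of_isPushout (isPushout_of_shortExact_hom hD (shortExact_at hS i) ψ)

/-- A factorization at a vertex of a morphism of representations. -/
structure VertexFactorization {F G : Rep Q A} (f : F ⟶ G) (i : Q) where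
  /-- The middle object. -/
  obj : A
  /-- The first factor. -/
  left : F.at i ⟶ obj
  /-- The second factor. -/
  right : obj ⟶ G.at i
  fac : left ≫ right = Rep.appAt f i

lemma exists_factorization_latchingMap {X Y : ObjectProperty A} (h : IsApproximationPair X Y)
    (hQ : WellFounded (arrowRel Q)) {F G : Rep Q A} (f : F ⟶ G) :
    ∃ (E : Rep Q A) (η : F ⟶ E) (π : E ⟶ G), (∀ i, IsMonoWith X (latchingMap η i)) ∧
      (∀ i, IsEpiWith Y (Rep.appAt π i)) ∧ η ≫ π = f := by
  obtain ⟨d, hd⟩ := exists_forall_of_wellFounded hQ (D := VertexFactorization f)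
    -- The map `w` is the future latching map at `i`. Its restriction to the coproduct of earlier
    -- middle objects supplies the arrows of `E` into `i`, and the last equation makes the right
    -- factors compatible with arrows.
    (fun i d x => ∃ w : pushout (phi F i)
        (Limits.Sigma.map fun a : Quiver.Costar i => (d a.1 ⟨a.2⟩).left) ⟶ x.obj,
      IsMonoWith X w ∧ IsEpiWith Y x.right ∧ pushout.inl _ _ ≫ w = x.left ∧
      pushout.inr _ _ ≫ w ≫ x.right =
        Sigma.desc fun a : Quiver.Costar i => (d a.1 ⟨a.2⟩).right ≫ G.arrow a.2) (by
    intro i d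
    have comm : phi F i ≫ Rep.appAt f i =
        (Limits.Sigma.map fun a : Quiver.Costar i => (d a.1 ⟨a.2⟩).left) ≫
          Sigma.desc fun a : Quiver.Costar i => (d a.1 ⟨a.2⟩).right ≫ G.arrow a.2 := by
      apply Sigma.hom_ext
      intro a
      rw [reassoc_of% ι_phi F a, Sigma.ι_map_assoc, Sigma.ι_desc,
        reassoc_of% (d a.1 ⟨a.2⟩).fac, f.naturality]
    obtain ⟨E, j, p, hj, hp, fac⟩ := h.exists_factorization (pushout.desc _ _ comm)
    refine ⟨⟨E, pushout.inl _ _ ≫ j, p, ?_⟩, j, hj, hp, rfl, ?_⟩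
    · rw [Category.assoc, fac, pushout.inl_desc]
    · rw [fac, pushout.inr_desc])
  choose w hw₁ hw₂ hw₃ hw₄ using hd
  let E : Rep Q A := Paths.lift
    { obj i := (d i).obj
      map {j i} a := Sigma.ι (fun a : Quiver.Costar i => (d a.1).obj) ⟨j, a⟩ ≫
        pushout.inr _ _ ≫ w i }
  have hE {j i : Q} (a : j ⟶ i) : E.arrow a =
      Sigma.ι (fun a : Quiver.Costar i => (d a.1).obj) ⟨j, a⟩ ≫ pushout.inr _ _ ≫ w i :=
    Rep.lift_arrow _ a
  let η : F ⟶ E := Rep.homMk (fun i => (d i).left) (by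
    intro j i a
    rw [hE]
    have := congrArg (fun t => Sigma.ι _ (⟨j, a⟩ : Quiver.Costar i) ≫ t ≫ w i)
      (pushout.condition (f := phi F i)
        (g := Limits.Sigma.map fun a : Quiver.Costar i => (d a.1).left))
    simp only [Category.assoc] at this
    rw [reassoc_of% ι_phi F (⟨j, a⟩ : Quiver.Costar i), Sigma.ι_map_assoc, hw₃] at this
    exact this)
  let π : E ⟶ G := Rep.homMk (fun i => (d i).right) (by
    intro j i a
    have key : (Sigma.ι (fun a : Quiver.Costar i => (d a.1).obj) ⟨j, a⟩ ≫
        pushout.inr _ _ ≫ w i) ≫ (d i).right = (d j).right ≫ G.arrow a := by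
      rw [Category.assoc, Category.assoc, hw₄, Sigma.ι_desc]
    exact (congrArg (· ≫ (d i).right) (hE a)).trans key)
  refine ⟨E, η, π, fun i => ?_, hw₂, Rep.hom_ext fun i => (d i).fac⟩
  have : latchingMap η i = w i := by
    apply pushout.hom_ext
    · exact (pushout.inl_desc _ _ _).trans (hw₃ i).symm
    · refine (pushout.inr_desc _ _ _).trans (Sigma.hom_ext _ _ fun a => ?_)
      exact (ι_phi E a).trans (hE a.2)
  rw [this]
  exact hw₁ i

lemma phi_iff {X : ObjectProperty A} [X.IsClosedUnderIsomorphisms] (F : Rep Q A) :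
    Phi Q X F ↔ ∀ i, IsMonoWith X (phi F i) :=
  forall_congr' fun _ => (isMonoWith_iff _).symm

/-- A retract of arrows induces a retract of cokernels. -/
def retractCokernel {M N M' N' : A} {f : M ⟶ N} {g : M' ⟶ N'} (r : RetractArrow f g) :
    Retract (cokernel f) (cokernel g) where
  i := cokernel.map f g r.i.left r.i.right r.i_w.symm
  r := cokernel.map g f r.r.left r.r.right r.r_w.symm
  retract := by
    apply coequalizer.hom_ext
    simp

instance (X : ObjectProperty A) [X.IsStableUnderRetracts] : (Phi Q X).IsStableUnderRetracts where
  of_retract {F G} r h i := by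
    obtain ⟨ρ⟩ := retract_phi r i
    exact ⟨(MorphismProperty.monomorphisms A).of_retract ρ (h i).1,
      X.prop_of_retract (retractCokernel ρ) (h i).2⟩

instance (Y : ObjectProperty A) [Y.IsStableUnderRetracts] : (repIn Q Y).IsStableUnderRetracts where
  of_retract r h i :=
    Y.prop_of_retract (r.map ((evaluation (Paths Q) A).obj ((Paths.of Q).obj i))) (h i)

/-- A section of `S.g` is built recursively. At `i`, compatibility with incoming arrows prescribes
it along `phi S.X₃ i`, so extending it is a lifting problem against `Rep.appAt S.g i` over the
identity. -/
lemma nonempty_splitting_of_phi {X Y : ObjectProperty A} (h : IsApproximationPair X Y)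
    (hQ : WellFounded (arrowRel Q)) {S : ShortComplex (Rep Q A)} (hS : S.ShortExact)
    (h₃ : Phi Q X S.X₃) (h₁ : repIn Q Y S.X₁) : Nonempty S.Splitting := by
  have := h.retract_left
  rw [phi_iff] at h₃
  obtain ⟨d, hd⟩ := exists_forall_of_wellFounded hQ
    (D := fun i => { s : S.X₃.at i ⟶ S.X₂.at i // s ≫ Rep.appAt S.g i = 𝟙 _ })
    (fun i d x => ∀ a : Quiver.Costar i,
      S.X₃.arrow a.2 ≫ x.1 = (d a.1 ⟨a.2⟩).1 ≫ S.X₂.arrow a.2) (by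
    intro i d
    obtain ⟨l, hl, hl'⟩ := h.exists_square_lift (h₃ i) ⟨_, _, _, shortExact_at hS i, h₁ i⟩
      (Sigma.desc fun a : Quiver.Costar i => (d a.1 ⟨a.2⟩).1 ≫ S.X₂.arrow a.2) (𝟙 _) (by
        apply Sigma.hom_ext
        intro a
        rw [Category.comp_id, ι_phi, Sigma.ι_desc_assoc, Category.assoc, S.g.naturality,
          reassoc_of% (d a.1 ⟨a.2⟩).2])
    refine ⟨⟨l, hl'⟩, fun a => ?_⟩
    rw [← ι_phi, Category.assoc, hl, Sigma.ι_desc])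
  exact ⟨ShortComplex.Splitting.ofExactOfSection S hS.exact
    (Rep.homMk (fun i => (d i).1) fun {j i} a => hd i ⟨j, a⟩)
    (Rep.hom_ext fun i => (d i).2) hS.mono_f⟩

open ZeroObject in
theorem isApproximationPair_phi_repIn {X Y : ObjectProperty A} (h : IsApproximationPair X Y)
    (hA : MonoSigmaMap.{w} A) (hQ : WellFounded (arrowRel Q)) :
    IsApproximationPair (Phi Q X) (repIn Q Y) := by
  have := h.retract_left
  have := h.retract_right
  refine ⟨fun S hS h₃ h₁ => nonempty_splitting_of_phi h hQ hS h₃ h₁, fun M => ?_, fun M => ?_,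
    inferInstance, inferInstance⟩
  · obtain ⟨E, η, π, hη, hπ, _⟩ := exists_factorization_latchingMap h hQ (0 : (0 : Rep Q A) ⟶ M)
    have := Rep.epi_of_epi_appAt π fun i => (hπ i).epi
    have hS : (ShortComplex.mk _ π (kernel.condition π)).ShortExact :=
      { exact := ShortComplex.exact_kernel π }
    refine ⟨_, hS, fun i => (hπ i).prop_X₁ (shortExact_at hS i), ?_, ⟨Iso.refl _⟩⟩
    have hT := shortExact_id_right (isZero_zero _) η
    exact (phi_iff _).2 fun i => isMonoWith_phi_of_latchingMap hA hT i (hη i)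
  · obtain ⟨E, η, π, hη, hπ, _⟩ := exists_factorization_latchingMap h hQ (0 : M ⟶ (0 : Rep Q A))
    have := Rep.mono_of_mono_appAt η
      (mono_appAt_of_latchingMap hA hQ η fun i => (hη i).mono)
    have hS : (ShortComplex.mk η _ (cokernel.condition η)).ShortExact :=
      { exact := ShortComplex.exact_cokernel η }
    refine ⟨_, hS, (phi_iff _).2 fun i => isMonoWith_phi_of_latchingMap hA hS i (hη i), ?_,
      ⟨Iso.refl _⟩⟩
    have hT := shortExact_id_left (isZero_zero _) π
    exact fun i => (hπ i).prop_X₁ (shortExact_at hT i)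

end Representations

/-! ### Duality and the cotorsion pair `(Rep(Q, X), Ψ(Y))` -/

section Opposite

open Opposite

lemma monoSigmaMap_op_of_AB4Star {A : Type u} [Category.{v} A] [Abelian A] [HasProducts.{w} A]
    [AB4StarOfSize.{w} A] : MonoSigmaMap.{w} Aᵒᵖ := by
  intro J f g φ hφ
  let α : Discrete.functor (fun j => (g j).unop) ⟶ Discrete.functor (fun j => (f j).unop) :=
    Discrete.natTrans fun j => (φ j.as).unop
  have : ∀ j, Epi (α.app j) := fun j => inferInstanceAs (Epi (φ j.as).unop)
  have : Epi α := NatTrans.epi_of_epi_app α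
  have : Epi (Limits.Pi.map fun j => (φ j).unop) := inferInstanceAs (Epi (lim.map α))
  have key : Limits.Sigma.map φ = (opProductIsoCoproduct fun j => (f j).unop).inv ≫
      (Limits.Pi.map fun j => (φ j).unop).op ≫
      (opProductIsoCoproduct fun j => (g j).unop).hom := by
    refine Sigma.hom_ext _ _ fun j => ?_
    have hf : Sigma.ι f j = (Pi.π (fun j => (f j).unop) j).op ≫
      (opProductIsoCoproduct fun j => (f j).unop).hom := (π_comp_opProductIsoCoproduct_hom _ j).symm
    have hg : Sigma.ι g j = (Pi.π (fun j => (g j).unop) j).op ≫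
      (opProductIsoCoproduct fun j => (g j).unop).hom := (π_comp_opProductIsoCoproduct_hom _ j).symm
    have hπ := congrArg Quiver.Hom.op (Limits.Pi.map_π (fun j => (φ j).unop) j)
    rw [op_comp, op_comp] at hπ
    rw [Sigma.ι_map, hf, hg, Category.assoc, Iso.hom_inv_id_assoc, reassoc_of% hπ,
      Quiver.Hom.op_unop]
  rw [key]
  infer_instance

lemma IsMonoWith.iso_comp {C : Type u} [Category.{v} C] [Abelian C] {X : ObjectProperty C}
    {M M' N : C} {f : M ⟶ N} (h : IsMonoWith X f) (e : M' ≅ M) : IsMonoWith X (e.hom ≫ f) :=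
  h.of_isPushout (k := e.inv) (q := 𝟙 _) (IsPushout.of_vert_isIso ⟨by simp⟩)

lemma isMonoWith_iso_comp_iff {C : Type u} [Category.{v} C] [Abelian C] {X : ObjectProperty C}
    {M M' N : C} (e : M' ≅ M) (f : M ⟶ N) : IsMonoWith X (e.hom ≫ f) ↔ IsMonoWith X f :=
  ⟨fun h => by simpa using h.iso_comp e.symm, fun h => h.iso_comp e⟩

lemma isMonoWith_op_iff {C : Type u} [Category.{v} C] [Abelian C] {Y : ObjectProperty C}
    {M N : C} (f : M ⟶ N) : IsMonoWith Y.op f.op ↔ IsEpiWith Y f := by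
  constructor
  · rintro ⟨Z, p, w, hS, hZ⟩
    exact ⟨Z.unop, p.unop, congrArg Quiver.Hom.unop w, hS.unop, hZ⟩
  · rintro ⟨Z, p, w, hS, hZ⟩
    exact ⟨op Z, p.op, congrArg Quiver.Hom.op w, hS.op, hZ⟩

lemma isEpiWith_iff {C : Type u} [Category.{v} C] [Abelian C] {Y : ObjectProperty C}
    [Y.IsClosedUnderIsomorphisms] {M N : C} (f : M ⟶ N) :
    IsEpiWith Y f ↔ Epi f ∧ Y (kernel f) := by
  refine ⟨fun h => ⟨h.epi, ?_⟩, fun ⟨_, h⟩ => ?_⟩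
  · have := h.epi
    exact h.prop_X₁ (S := .mk _ f (kernel.condition f)) { exact := ShortComplex.exact_kernel f }
  · exact ⟨_, _, kernel.condition f, { exact := ShortComplex.exact_kernel f }, h⟩

/-- Pass to the double opposite and pull back along its equivalence with `C`. -/
lemma IsApproximationPair.unop {C : Type u} [Category.{v} C] [Abelian C]
    {X Y : ObjectProperty Cᵒᵖ} (h : IsApproximationPair X Y) :
    IsApproximationPair Y.unop X.unop :=
  have : (opOp C).IsEquivalence := (opOpEquivalence C).isEquivalence_inverse
  h.op.inverseImage (opOp C)

variable {Q : Type w} [Quiver.{w} Q] {A : Type u} [Category.{v} A]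

variable (Q A) in
/-- Representations of the opposite quiver in the opposite category. -/
def opRep : (Rep Q A)ᵒᵖ ⥤ Rep Qᵒᵖ Aᵒᵖ where
  obj F := Paths.lift
    { obj i := op (F.unop.at i.unop)
      map a := (F.unop.arrow a.unop).op }
  map {F G} η := Rep.homMk (fun i => (Rep.appAt η.unop i.unop).op) (fun {i j} a => by
    refine (congrArg (· ≫ (Rep.appAt η.unop j.unop).op) (Rep.lift_arrow _ a)).trans
      (Eq.trans ?_ (congrArg ((Rep.appAt η.unop i.unop).op ≫ ·) (Rep.lift_arrow _ a)).symm)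
    exact congrArg Quiver.Hom.op (η.unop.naturality _).symm)
  map_id _ := Rep.hom_ext fun _ => rfl
  map_comp _ _ := Rep.hom_ext fun _ => rfl

lemma opRep_arrow (F : Rep Q A) {i j : Qᵒᵖ} (a : i ⟶ j) :
    Rep.arrow ((opRep Q A).obj (op F)) a = (F.arrow a.unop).op :=
  Rep.lift_arrow _ a

instance : (opRep Q A).Faithful where
  map_injective {F G _ _} h := Quiver.Hom.unop_inj <| Rep.hom_ext fun i =>
    congrArg (fun ζ : (opRep Q A).obj F ⟶ (opRep Q A).obj G => (Rep.appAt ζ (op i)).unop) h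

instance : (opRep Q A).Full where
  map_surjective {F G} η := by
    refine ⟨(Rep.homMk (fun i => (Rep.appAt η (op i)).unop) fun {i j} a => ?_).op,
      Rep.hom_ext fun _ => rfl⟩
    have h := η.naturality ((Paths.of Qᵒᵖ).map a.op)
    have h' := ((congrArg (· ≫ _) (opRep_arrow F.unop a.op)).symm.trans h).trans
      (congrArg (_ ≫ ·) (opRep_arrow G.unop a.op))
    exact (congrArg Quiver.Hom.unop h').symm

instance : (opRep Q A).EssSurj where
  mem_essImage G := by
    let F : Rep Q A := Paths.lift
      { obj i := (G.at (op i)).unop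
        map a := (G.arrow a.op).unop }
    have hF {i j : Qᵒᵖ} (a : i ⟶ j) : Rep.arrow ((opRep Q A).obj (op F)) a = G.arrow a := by
      rw [opRep_arrow]
      exact congrArg Quiver.Hom.op (Rep.lift_arrow _ a.unop)
    -- Both representations have definitionally equal vertex objects, so identities serve as
    -- components; `hF` handles the arrows.
    refine ⟨op F, ⟨Rep.homMk (fun i => 𝟙 (G.at i)) fun a => ?_,
      Rep.homMk (fun i => 𝟙 (G.at i)) fun a => ?_, ?_, ?_⟩⟩
    · exact (Category.comp_id _).trans ((hF a).trans (Category.id_comp _).symm)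
    · exact (Category.comp_id _).trans ((hF a).symm.trans (Category.id_comp _).symm)
    · exact Rep.hom_ext fun i => Category.id_comp (𝟙 (G.at i))
    · exact Rep.hom_ext fun i => Category.id_comp (𝟙 (G.at i))

instance : (opRep Q A).IsEquivalence where

variable [HasProducts.{w} A]

/-- The product defining `ψ` is the coproduct defining `φ` in the opposite category. -/
def opPsiIso (F : Rep Q A) (i : Qᵒᵖ) :
    (∐ fun a : Quiver.Costar i => Rep.at ((opRep Q A).obj (op F)) a.1) ≅
      op (∏ᶜ fun a : Quiver.Star i.unop => F.at a.1) where
  hom := Sigma.desc fun a => (Pi.π (fun a : Quiver.Star i.unop => F.at a.1) ⟨a.1.unop, a.2.unop⟩).op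
  inv := (Pi.lift fun a : Quiver.Star i.unop =>
    (Sigma.ι (fun a : Quiver.Costar i => Rep.at ((opRep Q A).obj (op F)) a.1)
      ⟨op a.1, a.2.op⟩).unop).op
  hom_inv_id := by
    apply Sigma.hom_ext
    intro a
    refine (Sigma.ι_desc_assoc _ _ _).trans (Eq.trans ?_ (Category.comp_id _).symm)
    exact congrArg Quiver.Hom.op (Pi.lift_π _ _)
  inv_hom_id := by
    apply Quiver.Hom.unop_inj
    apply Pi.hom_ext
    intro a
    refine (Category.assoc _ _ _).trans (Eq.trans ?_ (Category.id_comp _).symm)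
    refine (congrArg (_ ≫ ·) (Pi.lift_π _ _)).trans ?_
    have h := Sigma.ι_desc (f := fun a : Quiver.Costar i => Rep.at ((opRep Q A).obj (op F)) a.1)
      (fun a => (Pi.π (fun a : Quiver.Star i.unop => F.at a.1) ⟨a.1.unop, a.2.unop⟩).op)
      ⟨op a.1, a.2.op⟩
    exact congrArg Quiver.Hom.unop h

lemma opPsiIso_hom_comp (F : Rep Q A) (i : Qᵒᵖ) :
    (opPsiIso F i).hom ≫ (psi F i.unop).op = phi ((opRep Q A).obj (op F)) i := by
  apply Sigma.hom_ext
  intro a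
  refine (Sigma.ι_desc_assoc _ _ _).trans
    (Eq.trans ?_ ((ι_phi _ a).trans (opRep_arrow F a.2)).symm)
  exact congrArg Quiver.Hom.op (Pi.lift_π _ _)

variable [Abelian A]

lemma psi_iff {Y : ObjectProperty A} [Y.IsClosedUnderIsomorphisms] (F : Rep Q A) :
    Psi Q Y F ↔ ∀ i, IsEpiWith Y (psi F i) :=
  forall_congr' fun _ => (isEpiWith_iff _).symm

lemma phi_opRep_iff {Y : ObjectProperty A} [Y.IsStableUnderRetracts] (F : Rep Q A) :
    Phi Qᵒᵖ Y.op ((opRep Q A).obj (op F)) ↔ Psi Q Y F := by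
  rw [phi_iff, psi_iff]
  have (i : Qᵒᵖ) : IsMonoWith Y.op (phi ((opRep Q A).obj (op F)) i) ↔
      IsEpiWith Y (psi F i.unop) := by
    rw [← isMonoWith_op_iff, ← opPsiIso_hom_comp]
    exact isMonoWith_iso_comp_iff _ _
  exact ⟨fun h i => (this (op i)).1 (h _), fun h i => (this i).2 (h _)⟩

theorem isApproximationPair_repIn_psi {X Y : ObjectProperty A} (h : IsApproximationPair X Y)
    (hA : MonoSigmaMap.{w} Aᵒᵖ) (hQ : WellFounded (arrowRel Qᵒᵖ)) :
    IsApproximationPair (repIn Q X) (Psi Q Y) := by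
  have := h.retract_right
  -- The left rooted case for `Qᵒᵖ` and the pair `(Y.op, X.op)` in `Aᵒᵖ`, transported back.
  have key := ((isApproximationPair_phi_repIn h.op hA hQ).inverseImage (opRep Q A)).unop
  convert key using 1
  · ext F
    exact ⟨fun h i => h i.unop, fun h i => h (op i)⟩
  · ext F
    exact (phi_opRep_iff F).symm

end Opposite

end QuiverCotorsion

end

theorem mainTheorem3 {A : Type u} [Category.{v} A] [Abelian A] (Q : Type w) [Quiver.{w} Q]
    (X Y : ObjectProperty A) (hXY : QuiverCotorsion.IsCompleteCotorsionPair X Y) :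
    (∀ [HasCoproducts.{w} A] [AB4OfSize.{w} A], QuiverCotorsion.IsLeftRooted Q →
      QuiverCotorsion.IsCompleteCotorsionPair
        (QuiverCotorsion.Phi Q X) (QuiverCotorsion.repIn Q Y)) ∧
    (∀ [HasProducts.{w} A] [AB4StarOfSize.{w} A], QuiverCotorsion.IsRightRooted Q →
      QuiverCotorsion.IsCompleteCotorsionPair
        (QuiverCotorsion.repIn Q X) (QuiverCotorsion.Psi Q Y)) :=
  ⟨fun hQ => (QuiverCotorsion.isApproximationPair_phi_repIn hXY.isApproximationPair
      (QuiverCotorsion.monoSigmaMap_of_AB4 A) hQ.wellFounded).isCompleteCotorsionPair,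
    fun hQ => (QuiverCotorsion.isApproximationPair_repIn_psi hXY.isApproximationPair
      QuiverCotorsion.monoSigmaMap_op_of_AB4Star
      (QuiverCotorsion.IsLeftRooted.wellFounded hQ)).isCompleteCotorsionPair⟩
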